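/- Let $d\ge 1$ be fixed. In the unipoint model an uncertain point set in $\mathbb R^d$ consists of $n$ distinct sites $s_1,\dots,s_n\in\mathbb R^d$ with probabilities $p_1,\dots,p_n\in(0,1]$; site $s_i$ exists with probability $p_i$, independently of the other sites. In the multipoint model the $n$ distinct sites are partitioned among finitely many uncertain points; the probabilities, in $(0,1]$, of the sites of one uncertain point sum to at most $1$; each uncertain point is located at one of its sites with the probability of that site, or (with the remaining probability) does not exist; and different uncertain points are independent. In either model the membership probability $\mu(q)$ of $q\in\mathbb R^d$ is the probability that $q$ lies in the convex hull of the random set of existing sites. The probability map is the subdivision of $\mathbb R^d$ into regions, that is, into the maximal connected sets on which $\mu$ is constant. Its faces (of all dimensions) are the maximal connected sets $F\subseteq\mathbb R^d$ such that for all $x,y\in F$ one has $\mu(x+v)=\mu(y+v)$ for all sufficiently small $v\in\mathbb R^d$. The worst-case complexity of the probability map, that is, the maximum of its complexity over all uncertain point sets with $n$ sites in total, is finite for every $n$ and is $\Theta(n^{d^2})$ as $n\to\infty$, with constants depending only on $d$, in both the unipoint and the multipoint model. This holds both if the complexity is counted as the number of regions and if it is counted as the number of faces of all dimensions. -/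

import Mathlib

open Filter Topology Asymptotics

namespace UncertainHull

/-- An uncertain point set in the unipoint model in `ℝ^d` with `n` (distinct) sites: the `i`-th site
exists, independently of the others, with probability `prob i ∈ (0,1]`. -/
structure UnipointInput (d n : ℕ) where
  site : Fin n → EuclideanSpace ℝ (Fin d)
  site_injective : Function.Injective site
  prob : Fin n → ℝ
  prob_pos : ∀ i, 0 < prob i
  prob_le_one : ∀ i, prob i ≤ 1

open Classical in
/-- The probability that `q` lies in the convex hull of the random set of existing sites: the sum,
over all outcomes `B` whose convex hull contains `q`, of the probability of `B`. -/
noncomputable def UnipointInput.membershipProb {d n : ℕ} (P : UnipointInput d n)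
    (q : EuclideanSpace ℝ (Fin d)) : ℝ :=
  ∑ B ∈ Finset.univ.filter
      (fun B : Finset (Fin n) => q ∈ convexHull ℝ (P.site '' (B : Set (Fin n)))),
    (∏ i ∈ B, P.prob i) * ∏ i ∈ Bᶜ, (1 - P.prob i)

/-- An uncertain point set in the multipoint model in `ℝ^d` with `n` (distinct) sites in total.
There are `m` uncertain points; site `i` is one of the possible locations of the uncertain point
`owner i`, which is at that site with probability `prob i ∈ (0,1]`. The probabilities of the sites
of one uncertain point sum to at most `1`. -/
structure MultipointInput (d n : ℕ) where
  m : ℕ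
  owner : Fin n → Fin m
  site : Fin n → EuclideanSpace ℝ (Fin d)
  site_injective : Function.Injective site
  prob : Fin n → ℝ
  prob_pos : ∀ i, 0 < prob i
  prob_le_one : ∀ i, prob i ≤ 1
  sum_prob_le_one : ∀ k, ∑ i with owner i = k, prob i ≤ 1

namespace MultipointInput

variable {d n : ℕ}

/-- An outcome selects, for every uncertain point `k`, one of its sites or (`none`) the null
location. -/
abbrev Outcome (P : MultipointInput d n) : Type :=
  (k : Fin P.m) → Option {i : Fin n // P.owner i = k}

/-- The probability of a single selection for the uncertain point `k`. -/
noncomputable def choiceProb (P : MultipointInput d n) (k : Fin P.m) :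
    Option {i : Fin n // P.owner i = k} → ℝ
  | some i => P.prob i
  | none => 1 - ∑ i with P.owner i = k, P.prob i

/-- The set of sites that exist in an outcome. -/
def existing (P : MultipointInput d n) (o : P.Outcome) : Set (EuclideanSpace ℝ (Fin d)) :=
  {x | ∃ k, ∃ i : {i : Fin n // P.owner i = k}, o k = some i ∧ P.site i = x}

open Classical in
/-- The probability that `q` lies in the convex hull of the random set of existing sites, the
locations of the `m` uncertain points being independent. -/
noncomputable def membershipProb (P : MultipointInput d n) (q : EuclideanSpace ℝ (Fin d)) : ℝ :=
  ∑ o ∈ Finset.univ.filter (fun o : P.Outcome => q ∈ convexHull ℝ (P.existing o)),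
    ∏ k, P.choiceProb k (o k)

end MultipointInput

/-- The regions of the subdivision of `ℝ^d` induced by `f`: the maximal connected sets on which `f`
is constant. The probability map is the family of regions of the membership probability. -/
def regions {d : ℕ} (f : EuclideanSpace ℝ (Fin d) → ℝ) : Set (Set (EuclideanSpace ℝ (Fin d))) :=
  {R | Maximal (fun S => IsConnected S ∧ ∀ x ∈ S, ∀ y ∈ S, f x = f y) R}

/-- The faces, of all dimensions, of the subdivision of `ℝ^d` induced by `f`: the maximal connected
sets such that the subdivision looks the same (up to translation) around any two of their points.
For the indicator function of a convex polygon, say, these are its interior, its exterior, its open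
edges and its vertices. -/
def faces {d : ℕ} (f : EuclideanSpace ℝ (Fin d) → ℝ) : Set (Set (EuclideanSpace ℝ (Fin d))) :=
  {F | Maximal (fun S => IsConnected S ∧
    ∀ x ∈ S, ∀ y ∈ S, ∀ᶠ v in 𝓝 (0 : EuclideanSpace ℝ (Fin d)), f (x + v) = f (y + v)) F}

/-- The largest number of regions of the probability map, over all unipoint inputs with `n` sites. -/
noncomputable def worstRegionsUnipoint (d n : ℕ) : ℕ∞ :=
  ⨆ P : UnipointInput d n, (regions P.membershipProb).encard

/-- The largest number of faces of the probability map, over all unipoint inputs with `n` sites. -/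
noncomputable def worstFacesUnipoint (d n : ℕ) : ℕ∞ :=
  ⨆ P : UnipointInput d n, (faces P.membershipProb).encard

/-- The largest number of regions of the probability map, over all multipoint inputs with `n` sites
in total. -/
noncomputable def worstRegionsMultipoint (d n : ℕ) : ℕ∞ :=
  ⨆ P : MultipointInput d n, (regions P.membershipProb).encard

/-- The largest number of faces of the probability map, over all multipoint inputs with `n` sites
in total. -/
noncomputable def worstFacesMultipoint (d n : ℕ) : ℕ∞ :=
  ⨆ P : MultipointInput d n, (faces P.membershipProb).encard

/-- `W n` is finite for every `n`, and `W n = Θ(n^k)` as `n → ∞`. -/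
def IsThetaPow (W : ℕ → ℕ∞) (k : ℕ) : Prop :=
  (∀ n, W n ≠ ⊤) ∧
    (fun n : ℕ => ((W n).toNat : ℝ)) =Θ[atTop] fun n : ℕ => (n : ℝ) ^ k

end UncertainHull

namespace UncertainHull

/-! ### Counting the sign vectors of finitely many affine functions -/

/-! Upper bound: `μ(q)` depends only on which sets of sites have `q` in their convex hull. After
adjoining an affine basis, all sites lie in a spanning set `Q` of at most `n + d + 1` points. By
Carathéodory, hull membership is decided by simplices; each extends to an affine basis inside `Q`,
so the signs of barycentric coordinates decide it. Up to a factor such a coordinate is determined by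
the `d` points where it vanishes, so `|Q| ^ d` affine functions suffice
(`mem_convexHull_of_signVector_eq`). An arrangement of `M` hyperplanes has `O(M ^ d)` cells
(`ncard_range_signVector_le`). Cells are convex, and both `μ` and its germ are constant along a
cell, so regions and faces number `O(n ^ (d ^ 2))`.

Lower bound: each region and each face carries a single value of `μ`, so it suffices to produce many
values. With odds `2 ^ 2 ^ i`, `μ(q)` encodes in binary the whole family of site sets whose hull
contains `q`. For each coordinate `j`, take `d` clusters of about `n / d ^ 2` sites near the
vertices of a simplex in `x_j = 0`; one site per cluster spans a simplex close to that hyperplane.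
Simplices chosen one for each `j` meet near the origin (`exists_common_point`), while two simplices
with the same `j` are disjoint there, their heights being distinct powers of a small number
(`eq_of_sum_mul_pow_eq`). This gives `(n / d ^ 2) ^ (d ^ 2)` distinct values. The multipoint model
contains the unipoint model. -/

theorem sign_lineMap_of_sign_eq {a b c : ℝ} (h : SignType.sign a = SignType.sign b)
    (h0 : 0 ≤ c) (h1 : c ≤ 1) : SignType.sign (AffineMap.lineMap a b c) = SignType.sign a := by
  rw [AffineMap.lineMap_apply_module]
  simp only [smul_eq_mul]
  have h1' : 0 ≤ 1 - c := by linarith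
  rcases lt_trichotomy a 0 with ha | ha | ha
  · have hb : b < 0 := by
      rw [sign_neg ha] at h
      exact sign_eq_neg_one_iff.1 h.symm
    rw [sign_neg ha, sign_neg]
    rcases h0.eq_or_lt with rfl | hc
    · simpa using ha
    · nlinarith [mul_pos hc (neg_pos.2 hb), mul_nonneg h1' (neg_pos.2 ha).le]
  · have hb : b = 0 := by
      rw [ha, sign_zero] at h
      exact sign_eq_zero_iff.1 h.symm
    simp [ha, hb]
  · have hb : 0 < b := by
      rw [sign_pos ha] at h
      exact sign_eq_one_iff.1 h.symm
    rw [sign_pos ha, sign_pos]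
    rcases h0.eq_or_lt with rfl | hc
    · simpa using ha
    · nlinarith [mul_pos hc hb, mul_nonneg h1' ha.le]

/-- The vector of signs of the functions `φ i` at `x`. -/
noncomputable def signVector {ι V : Type*} [AddCommGroup V] [Module ℝ V] (φ : ι → V →ᵃ[ℝ] ℝ)
    (x : V) : ι → SignType :=
  fun i => SignType.sign (φ i x)

theorem signVector_lineMap {ι V : Type*} [AddCommGroup V] [Module ℝ V] {φ : ι → V →ᵃ[ℝ] ℝ}
    {x y : V} (h : signVector φ x = signVector φ y) {c : ℝ} (h0 : 0 ≤ c) (h1 : c ≤ 1) :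
    signVector φ (AffineMap.lineMap x y c) = signVector φ x := by
  funext i
  simp only [signVector, AffineMap.apply_lineMap]
  exact sign_lineMap_of_sign_eq (congrFun h i) h0 h1

theorem convex_signVector_fiber {ι V : Type*} [AddCommGroup V] [Module ℝ V]
    (φ : ι → V →ᵃ[ℝ] ℝ) (s : ι → SignType) : Convex ℝ {x | signVector φ x = s} := by
  intro x hx y hy a b _ hb hab
  have hx' : signVector φ x = s := hx
  have hy' : signVector φ y = s := hy
  have := signVector_lineMap (φ := φ) (hx'.trans hy'.symm) hb (by linarith)
  rw [AffineMap.lineMap_apply_module, show 1 - b = a by linarith] at this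
  exact this.trans hx'

theorem sign_trichotomy (s : SignType) : s = -1 ∨ s = 0 ∨ s = 1 := by
  cases s <;> simp

/-- An arrangement of `m` hyperplanes in a space of dimension `k` has at most `(2 m + 1) ^ k`
cells. -/
theorem ncard_range_signVector_le (m : ℕ) : ∀ (k : ℕ) (V : Type) [AddCommGroup V] [Module ℝ V]
    [FiniteDimensional ℝ V], Module.finrank ℝ V = k → ∀ φ : Fin m → V →ᵃ[ℝ] ℝ,
    (Set.range (signVector φ)).ncard ≤ (2 * m + 1) ^ k := by
  induction m with
  | zero =>
    intro k V _ _ _ _ φ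
    refine (Set.ncard_le_one_of_subsingleton _).trans (by simp)
  | succ m ih =>
    intro k V _ _ _ hk φ
    set ψ : Fin m → V →ᵃ[ℝ] ℝ := fun i => φ i.succ with hψ
    have hcons : ∀ x, signVector φ x =
        Fin.cons (α := fun _ => SignType) (SignType.sign (φ 0 x)) (signVector ψ x) := by
      intro x
      funext i
      refine Fin.cases ?_ (fun j => ?_) i <;> simp [signVector, hψ]
    have hA := ih k V hk ψ
    -- A constant function contributes a single sign and creates no new cells.
    by_cases h0 : (φ 0).linear = 0
    · obtain ⟨c, hc⟩ : ∃ c, ∀ x, φ 0 x = c := by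
        refine ⟨φ 0 0, fun x => ?_⟩
        have := (φ 0).map_vadd 0 x
        simpa [h0] using this
      have hsub : Set.range (signVector φ) ⊆
          (Fin.cons (α := fun _ => SignType) (SignType.sign c)) '' Set.range (signVector ψ) := by
        rintro _ ⟨x, rfl⟩
        exact ⟨_, ⟨x, rfl⟩, by rw [hcons, hc]⟩
      calc _ ≤ _ := Set.ncard_le_ncard hsub
        _ ≤ _ := Set.ncard_image_le
        _ ≤ _ := hA
        _ ≤ _ := Nat.pow_le_pow_left (by omega) k
    -- `S s` collects the old cells that meet the part of the space where `φ 0` has sign `s`.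
    · set S : SignType → Set (Fin m → SignType) :=
        fun s => signVector ψ '' {x | SignType.sign (φ 0 x) = s} with hS
      have hker : Module.finrank ℝ (LinearMap.ker (φ 0).linear) + 1 = k := by
        rw [← hk]
        exact Module.Dual.finrank_ker_add_one_of_ne_zero h0
      obtain ⟨p, hp⟩ : ∃ p, φ 0 p = 0 := by
        have : Function.Surjective (φ 0).linear := LinearMap.surjective h0
        exact ((φ 0).linear_surjective_iff.1 this) 0
      -- The hyperplane `φ 0 = 0` is a translate by `p` of a space of dimension `k - 1`, so the
      -- induction hypothesis applies on it.
      have hS0 : (S 0).ncard ≤ (2 * m + 1) ^ (k - 1) := by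
        set K := LinearMap.ker (φ 0).linear
        set e : K →ᵃ[ℝ] V := K.subtype.toAffineMap + AffineMap.const ℝ K p with he
        have := ih (k - 1) K (by omega) (fun i => (ψ i).comp e)
        refine le_trans (Set.ncard_le_ncard ?_) this
        rintro _ ⟨x, hx, rfl⟩
        have hx0 : φ 0 x = 0 := sign_eq_zero_iff.1 hx
        refine ⟨⟨x - p, ?_⟩, ?_⟩
        · rw [LinearMap.mem_ker]
          have := (φ 0).linearMap_vsub x p
          simpa [hx0, hp] using this
        · funext i
          simp [signVector, he]
      -- A convex cell with points on both sides meets the hyperplane, at the zero of `φ 0` on the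
      -- segment joining them.
      have hinter : S 1 ∩ S (-1) ⊆ S 0 := by
        rintro s ⟨⟨x, hx, hxs⟩, ⟨y, hy, hys⟩⟩
        have hx' : 0 < φ 0 x := sign_eq_one_iff.1 hx
        have hy' : φ 0 y < 0 := sign_eq_neg_one_iff.1 hy
        have hd : 0 < φ 0 x - φ 0 y := by linarith
        refine ⟨AffineMap.lineMap x y (φ 0 x / (φ 0 x - φ 0 y)), ?_, ?_⟩
        · change SignType.sign _ = 0
          rw [sign_eq_zero_iff, AffineMap.apply_lineMap, AffineMap.lineMap_apply_module']
          simp only [smul_eq_mul]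
          field_simp
          ring
        · rw [signVector_lineMap (hxs.trans hys.symm) (by positivity), hxs]
          rw [div_le_one hd]
          linarith
      have hunion : (S 1 ∪ S (-1)).ncard ≤ (2 * m + 1) ^ k :=
        le_trans (Set.ncard_le_ncard (Set.union_subset (Set.image_subset_range _ _)
          (Set.image_subset_range _ _))) hA
      -- Only cells in the intersection are cut in two, so the new total is at most `|S 1 ∪ S (-1)|
      -- + 2 |S 0|`.
      have hcount := Set.ncard_union_add_ncard_inter (S 1) (S (-1))
      have hi := Set.ncard_le_ncard hinter
      set C : SignType → Set (Fin (m + 1) → SignType) :=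
        fun s => (Fin.cons (α := fun _ => SignType) s) '' S s with hC
      have hCle : ∀ s, (C s).ncard ≤ (S s).ncard := fun s => Set.ncard_image_le
      have hsub : Set.range (signVector φ) ⊆ C 1 ∪ C (-1) ∪ C 0 := by
        rintro _ ⟨x, rfl⟩
        have : signVector φ x ∈ C (SignType.sign (φ 0 x)) := ⟨_, ⟨x, rfl, rfl⟩, (hcons x).symm⟩
        rcases sign_trichotomy (SignType.sign (φ 0 x)) with h | h | h <;> rw [h] at this
        · exact Or.inl (Or.inr this)
        · exact Or.inr this
        · exact Or.inl (Or.inl this)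
      have h1 := Set.ncard_le_ncard hsub
      have h2 := Set.ncard_union_le (C 1 ∪ C (-1)) (C 0)
      have h3 := Set.ncard_union_le (C 1) (C (-1))
      have h4 := hCle 0
      have h5 := hCle 1
      have h6 := hCle (-1)
      obtain ⟨k, rfl⟩ : ∃ l, k = l + 1 := ⟨k - 1, by omega⟩
      simp only [Nat.add_sub_cancel] at hS0
      calc _ ≤ (2 * m + 1) ^ (k + 1) + 2 * (2 * m + 1) ^ k := by omega
        _ = (2 * m + 1) ^ k * (2 * (m + 1) + 1) := by ring
        _ ≤ (2 * (m + 1) + 1) ^ k * (2 * (m + 1) + 1) :=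
          Nat.mul_le_mul_right _ (Nat.pow_le_pow_left (by omega) k)
        _ = _ := by ring

theorem ncard_range_signVector_le_card {ι V : Type} [Fintype ι] [AddCommGroup V] [Module ℝ V]
    [FiniteDimensional ℝ V] (φ : ι → V →ᵃ[ℝ] ℝ) :
    (Set.range (signVector φ)).ncard ≤ (2 * Fintype.card ι + 1) ^ Module.finrank ℝ V := by
  have e := Fintype.equivFin ι
  refine le_trans (le_of_eq ?_) (ncard_range_signVector_le _ _ V rfl (fun i => φ (e.symm i)))
  have : signVector (fun i => φ (e.symm i)) = (fun s : ι → SignType => s ∘ e.symm) ∘ signVector φ :=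
    rfl
  rw [this, Set.range_comp, Set.ncard_image_of_injective]
  exact e.symm.surjective.injective_comp_right

/-! ### Maximal connected sets of equivalent points -/

section Pieces

variable {X : Type*} [TopologicalSpace X] {K : X → X → Prop}

/-- The maximal connected sets of points that are pairwise related by `K`. -/
def pieces (K : X → X → Prop) : Set (Set X) :=
  {R | Maximal (fun S => IsConnected S ∧ ∀ x ∈ S, ∀ y ∈ S, K x y) R}

theorem mem_pieces_prop {R : Set X} (hR : R ∈ pieces K) :
    IsConnected R ∧ ∀ x ∈ R, ∀ y ∈ R, K x y :=
  Maximal.prop (P := fun S => IsConnected S ∧ ∀ x ∈ S, ∀ y ∈ S, K x y) hR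

/-- `R ∪ S` is again connected with related points, so maximality of `R` absorbs `S`. -/
theorem subset_of_mem_pieces (hK : Equivalence K) {R S : Set X} (hR : R ∈ pieces K)
    (hS : IsPreconnected S) (hSK : ∀ x ∈ S, ∀ y ∈ S, K x y) (hRS : (R ∩ S).Nonempty) : S ⊆ R := by
  obtain ⟨z, hzR, hzS⟩ := hRS
  have hz : ∀ x ∈ R ∪ S, K x z := by
    rintro x (hx | hx)
    · exact (mem_pieces_prop hR).2 x hx z hzR
    · exact hSK x hx z hzS
  refine Set.subset_union_right.trans (hR.2 (y := R ∪ S) ⟨⟨⟨z, Or.inl hzR⟩, ?_⟩, ?_⟩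
    Set.subset_union_left)
  · exact (mem_pieces_prop hR).1.isPreconnected.union z hzR hzS hS
  · exact fun x hx y hy => hK.trans (hz x hx) (hK.symm (hz y hy))

/-- There are at most as many pieces as fibers of a map with connected fibers on which `K` holds. -/
theorem encard_pieces_le [Nonempty X] {α : Type*} (hK : Equivalence K) (σ : X → α)
    (hσ : ∀ a, IsPreconnected {x | σ x = a}) (hσK : ∀ x y, σ x = σ y → K x y) :
    (pieces K).encard ≤ (Set.range σ).encard := by
  classical
  have hne : ∀ R ∈ pieces K, R.Nonempty := fun R hR => (mem_pieces_prop hR).1.nonempty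
  choose! p hp using hne
  refine Set.encard_le_encard_of_injOn (f := fun R => σ (p R)) (fun R _ => ⟨p R, rfl⟩) ?_
  intro R hR R' hR' h
  -- A piece contains the full fiber of its chosen point, so two pieces with the same `σ`-value
  -- intersect and hence coincide.
  have key : ∀ T ∈ pieces K, {x | σ x = σ (p T)} ⊆ T := fun T hT =>
    subset_of_mem_pieces hK hT (hσ _) (fun x hx y hy => hσK x y (hx.trans hy.symm))
      ⟨p T, hp T hT, rfl⟩
  have hmem : p R' ∈ R := key R hR h.symm
  exact Set.Subset.antisymm
    (subset_of_mem_pieces hK hR' (mem_pieces_prop hR).1.isPreconnected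
      (mem_pieces_prop hR).2 ⟨_, hp R' hR', hmem⟩)
    (subset_of_mem_pieces hK hR (mem_pieces_prop hR').1.isPreconnected
      (mem_pieces_prop hR').2 ⟨_, hmem, hp R' hR'⟩)

/-- The piece is the connected component of `x` inside its equivalence class. -/
theorem exists_mem_pieces (hK : Equivalence K) (x : X) : ∃ R ∈ pieces K, x ∈ R := by
  have hx : x ∈ connectedComponentIn {y | K y x} x := mem_connectedComponentIn (hK.refl x)
  refine ⟨connectedComponentIn {y | K y x} x, ⟨⟨⟨⟨x, hx⟩, isPreconnected_connectedComponentIn⟩, ?_⟩,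
    ?_⟩, hx⟩
  · intro y hy z hz
    have hy' : K y x := connectedComponentIn_subset {y | K y x} x hy
    have hz' : K z x := connectedComponentIn_subset {y | K y x} x hz
    exact hK.trans hy' (hK.symm hz')
  · intro S hS hle
    exact hS.1.isPreconnected.subset_connectedComponentIn (hle hx)
      fun y hy => hS.2 y hy x (hle hx)

theorem encard_range_le_encard_pieces [Nonempty X] {α : Type*} (hK : Equivalence K) (f : X → α)
    (hf : ∀ x y, K x y → f x = f y) : (Set.range f).encard ≤ (pieces K).encard := by
  classical
  choose R hR hxR using exists_mem_pieces hK
  have hsec : ∀ a ∈ Set.range f, ∃ x, f x = a := fun a ha => ha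
  choose! g hg using hsec
  refine Set.encard_le_encard_of_injOn (f := fun a => R (g a)) (fun a _ => hR _) ?_
  intro a ha b hb h
  have h1 := hxR (g a)
  have h' : R (g a) = R (g b) := h
  rw [h'] at h1
  rw [← hg a ha, ← hg b hb]
  exact hf _ _ ((mem_pieces_prop (hR (g b))).2 _ h1 _ (hxR (g b)))

end Pieces

/-! ### Regions and faces as pieces, bounded by sign vectors. -/

variable {d n : ℕ}

theorem equivalence_germ (f : EuclideanSpace ℝ (Fin d) → ℝ) :
    Equivalence fun x y => ∀ᶠ v in 𝓝 (0 : EuclideanSpace ℝ (Fin d)), f (x + v) = f (y + v) where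
  refl _ := Eventually.of_forall fun _ => rfl
  symm h := h.mono fun _ hv => hv.symm
  trans h h' := (h.and h').mono fun _ hv => hv.1.trans hv.2

theorem equivalence_value (f : EuclideanSpace ℝ (Fin d) → ℝ) :
    Equivalence fun x y => f x = f y :=
  ⟨fun _ => rfl, fun h => h.symm, fun h h' => h.trans h'⟩

theorem encard_range_le_encard_regions (f : EuclideanSpace ℝ (Fin d) → ℝ) :
    (Set.range f).encard ≤ (regions f).encard :=
  encard_range_le_encard_pieces (equivalence_value f) f fun _ _ h => h

theorem encard_range_le_encard_faces (f : EuclideanSpace ℝ (Fin d) → ℝ) :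
    (Set.range f).encard ≤ (faces f).encard :=
  encard_range_le_encard_pieces (equivalence_germ f) f fun x y h => by simpa using h.self_of_nhds

section SignVector

variable {ι : Type} {φ : ι → EuclideanSpace ℝ (Fin d) →ᵃ[ℝ] ℝ}
  {f : EuclideanSpace ℝ (Fin d) → ℝ}

theorem isPreconnected_signVector_fiber (s : ι → SignType) :
    IsPreconnected {x | signVector φ x = s} :=
  (convex_signVector_fiber φ s).isPreconnected

variable [Fintype ι]

/-- Nonzero signs persist nearby by continuity; where `φ i` vanishes at both points, its values at
`x + v` and `y + v` both equal its linear part at `v`. This makes the cell bound valid for faces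
too. -/
theorem eventually_signVector_add_eq {x y : EuclideanSpace ℝ (Fin d)}
    (h : signVector φ x = signVector φ y) :
    ∀ᶠ v in 𝓝 (0 : EuclideanSpace ℝ (Fin d)),
      signVector φ (x + v) = signVector φ (y + v) := by
  have : ∀ i, ∀ᶠ v in 𝓝 (0 : EuclideanSpace ℝ (Fin d)),
      SignType.sign (φ i (x + v)) = SignType.sign (φ i (y + v)) := by
    intro i
    have hcont : ∀ z : EuclideanSpace ℝ (Fin d), Tendsto (fun v => φ i (z + v)) (𝓝 0)
        (𝓝 (φ i z)) := by
      intro z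
      have : Continuous fun v => φ i (z + v) :=
        (φ i).continuous_of_finiteDimensional.comp (continuous_const.add continuous_id)
      simpa using this.tendsto 0
    have hi : SignType.sign (φ i x) = SignType.sign (φ i y) := congrFun h i
    rcases lt_trichotomy (φ i x) 0 with hx | hx | hx
    · have hy : φ i y < 0 := by
        rw [sign_neg hx] at hi
        exact sign_eq_neg_one_iff.1 hi.symm
      filter_upwards [(hcont x).eventually_lt_const hx, (hcont y).eventually_lt_const hy]
        with v h1 h2
      rw [sign_neg h1, sign_neg h2]
    · have hy : φ i y = 0 := by
        rw [hx, sign_zero] at hi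
        exact sign_eq_zero_iff.1 hi.symm
      refine Eventually.of_forall fun v => ?_
      have e : ∀ z, φ i (z + v) = (φ i).linear v + φ i z := by
        intro z
        have := (φ i).map_vadd z v
        simpa [add_comm] using this
      rw [e, e, hx, hy]
    · have hy : 0 < φ i y := by
        rw [sign_pos hx] at hi
        exact sign_eq_one_iff.1 hi.symm
      filter_upwards [(hcont x).eventually_const_lt hx, (hcont y).eventually_const_lt hy]
        with v h1 h2
      rw [sign_pos h1, sign_pos h2]
  filter_upwards [eventually_all.2 this] with v hv
  funext i
  exact hv i

theorem encard_range_signVector_le :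
    (Set.range (signVector φ)).encard ≤ ((2 * Fintype.card ι + 1) ^ d : ℕ) := by
  have h := ncard_range_signVector_le_card φ
  rw [finrank_euclideanSpace_fin] at h
  rw [← (Set.toFinite (Set.range (signVector φ))).cast_ncard_eq]
  exact_mod_cast h

theorem encard_regions_le_of_signVector
    (hf : ∀ x y, signVector φ x = signVector φ y → f x = f y) :
    (regions f).encard ≤ ((2 * Fintype.card ι + 1) ^ d : ℕ) :=
  (encard_pieces_le (equivalence_value f) (signVector φ) isPreconnected_signVector_fiber hf).trans
    encard_range_signVector_le

theorem encard_faces_le_of_signVector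
    (hf : ∀ x y, signVector φ x = signVector φ y → f x = f y) :
    (faces f).encard ≤ ((2 * Fintype.card ι + 1) ^ d : ℕ) :=
  (encard_pieces_le (equivalence_germ f) (signVector φ) isPreconnected_signVector_fiber
    fun _ _ h => (eventually_signVector_add_eq h).mono fun _ hv => hf _ _ hv).trans
    encard_range_signVector_le

end SignVector

/-! ### Signs determine membership in convex hulls -/

theorem affineIndependent_insert_of_notMem_affineSpan {V : Type*} [AddCommGroup V] [Module ℝ V]
    {B : Set V} (hB : AffineIndependent ℝ ((↑) : B → V)) {q : V} (hq : q ∉ affineSpan ℝ B) :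
    AffineIndependent ℝ ((↑) : ↥(insert q B) → V) := by
  have hqB : q ∉ B := fun h => hq (subset_affineSpan ℝ B h)
  refine AffineIndependent.affineIndependent_of_notMem_span
    (i := (⟨q, Set.mem_insert q B⟩ : ↥(insert q B))) ?_ ?_
  · let g : {y : ↥(insert q B) // y ≠ ⟨q, Set.mem_insert q B⟩} ↪ B :=
      ⟨fun y => ⟨y.1.1, y.1.2.resolve_left fun h => y.2 (Subtype.ext h)⟩, by
        intro y z h
        simp only [Subtype.mk.injEq] at h
        exact Subtype.ext (Subtype.ext h)⟩
    exact hB.comp_embedding g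
  · have : ((↑) : ↥(insert q B) → V) '' {x | x ≠ ⟨q, Set.mem_insert q B⟩} ⊆ B := by
      rintro _ ⟨y, hy, rfl⟩
      exact y.2.resolve_left fun h => hy (Subtype.ext h)
    exact fun h => hq (affineSpan_mono ℝ this h)

/-- A maximal affinely independent subset of `Q` containing `T` spans, since any point of `Q`
outside its span could be added. -/
theorem exists_affineBasis_between {V : Type*} [AddCommGroup V] [Module ℝ V]
    {T Q : Set V} (hQ : Q.Finite) (hspan : affineSpan ℝ Q = ⊤) (hTQ : T ⊆ Q)
    (hT : AffineIndependent ℝ ((↑) : T → V)) :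
    ∃ B : Set V, T ⊆ B ∧ B ⊆ Q ∧ AffineIndependent ℝ ((↑) : B → V) ∧ affineSpan ℝ B = ⊤ := by
  have hfin : {B : Set V | B ⊆ Q ∧ AffineIndependent ℝ ((↑) : B → V)}.Finite :=
    hQ.finite_subsets.subset fun _ h => h.1
  obtain ⟨B, hTB, hB⟩ := hfin.exists_le_maximal (a := T) ⟨hTQ, hT⟩
  refine ⟨B, hTB, hB.prop.1, hB.prop.2, ?_⟩
  rw [eq_top_iff, ← hspan, affineSpan_le]
  intro q hq
  by_contra hqB
  exact hqB (subset_affineSpan ℝ B (hB.2 (y := insert q B) ⟨Set.insert_subset hq hB.prop.1,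
    affineIndependent_insert_of_notMem_affineSpan hB.prop.2 hqB⟩ (Set.subset_insert q B)
    (Set.mem_insert q B)))

open Classical in
/-- A nonzero affine function that vanishes at the points `t l`, if there is one. -/
noncomputable def vanishingFn {Q : Set (EuclideanSpace ℝ (Fin d))} (t : Fin d → Q) :
    EuclideanSpace ℝ (Fin d) →ᵃ[ℝ] ℝ :=
  if h : ∃ φ : EuclideanSpace ℝ (Fin d) →ᵃ[ℝ] ℝ, φ ≠ 0 ∧ ∀ l, φ (t l) = 0 then h.choose else 0

/-- An affine function vanishing at the other `d` basis points is fixed by its value at `b i`, so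
whichever one `vanishingFn` picks is a nonzero multiple of the coordinate. -/
theorem exists_vanishingFn_eq_smul_coord {Q B : Set (EuclideanSpace ℝ (Fin d))}
    (hBQ : B ⊆ Q) (b : AffineBasis B ℝ (EuclideanSpace ℝ (Fin d))) (hb : ∀ i, b i = i) (i : B) :
    ∃ (t : Fin d → Q) (c : ℝ), c ≠ 0 ∧ ∀ x, vanishingFn t x = c * b.coord i x := by
  classical
  have : Fintype B := Set.Finite.fintype (finite_set_of_fin_dim_affineIndependent ℝ b.ind)
  have hcard : Fintype.card B = d + 1 := by
    simpa using b.card_eq_finrank_add_one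
  have hcard' : Fintype.card {j : B // j ≠ i} = d := by
    rw [Fintype.card_subtype_compl, hcard]
    simp
  let e : Fin d ≃ {j : B // j ≠ i} := (Fintype.equivFinOfCardEq hcard').symm
  let t : Fin d → Q := fun l => ⟨(e l).1.1, hBQ (e l).1.2⟩
  have ht : ∀ j : B, j ≠ i → ∃ l, (t l : EuclideanSpace ℝ (Fin d)) = b j := fun j hj =>
    ⟨e.symm ⟨j, hj⟩, by simp [t, hb]⟩
  have hex : ∃ φ : EuclideanSpace ℝ (Fin d) →ᵃ[ℝ] ℝ, φ ≠ 0 ∧ ∀ l, φ (t l) = 0 := by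
    refine ⟨b.coord i, fun h => ?_, fun l => ?_⟩
    · have := b.coord_apply_eq i
      simp [h] at this
    · have h1 : (t l : EuclideanSpace ℝ (Fin d)) = b (e l).1 := (hb _).symm
      rw [h1]
      exact b.coord_apply_ne (e l).2.symm
  have hspec : vanishingFn t ≠ 0 ∧ ∀ l, vanishingFn t (t l) = 0 := by
    rw [vanishingFn, dif_pos hex]
    exact hex.choose_spec
  have heq : vanishingFn t = vanishingFn t (b i) • b.coord i := by
    refine AffineMap.ext_on b.tot ?_
    rintro _ ⟨j, rfl⟩
    by_cases hj : j = i
    · subst hj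
      simp
    · obtain ⟨l, hl⟩ := ht j hj
      simp [← hl, hspec.2 l]
      rw [hl, b.coord_apply_ne (Ne.symm hj)]
      simp
  refine ⟨t, vanishingFn t (b i), fun h => hspec.1 ?_, fun x => ?_⟩
  · rw [heq, h, zero_smul]
  · conv_lhs => rw [heq]
    simp

/-- Carathéodory puts `x` in a simplex on some `T ⊆ A`. In a basis `B ⊇ T` drawn from `Q`, lying in
that simplex means nonnegative coordinates that vanish off `T`: a condition on signs only. -/
theorem mem_convexHull_of_signVector_eq {A Q : Set (EuclideanSpace ℝ (Fin d))} (hQ : Q.Finite)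
    (hspan : affineSpan ℝ Q = ⊤) (hAQ : A ⊆ Q) {x y : EuclideanSpace ℝ (Fin d)}
    (hxy : signVector (vanishingFn (Q := Q)) x = signVector (vanishingFn (Q := Q)) y)
    (hx : x ∈ convexHull ℝ A) : y ∈ convexHull ℝ A := by
  classical
  rw [convexHull_eq_union] at hx
  simp only [Set.mem_iUnion] at hx
  obtain ⟨T, hTA, hT, hxT⟩ := hx
  obtain ⟨B, hTB, hBQ, hB, hBspan⟩ := exists_affineBasis_between hQ hspan (hTA.trans hAQ) hT
  let b : AffineBasis B ℝ (EuclideanSpace ℝ (Fin d)) := ⟨(↑), hB, by simpa using hBspan⟩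
  have hb : ∀ i, b i = i := fun i => rfl
  have : Fintype B := Set.Finite.fintype (hQ.subset hBQ)
  have hsign : ∀ i, SignType.sign (b.coord i x) = SignType.sign (b.coord i y) := by
    intro i
    obtain ⟨t, c, hc, hcoord⟩ := exists_vanishingFn_eq_smul_coord hBQ b hb i
    have h := congrFun hxy t
    simp only [signVector, hcoord, sign_mul] at h
    -- The sign of `c` is unknown, but it is the same at `x` and `y` and cancels.
    have hc' : SignType.sign c ≠ 0 := fun h => hc (sign_eq_zero_iff.1 h)
    exact mul_left_cancel₀ hc' h
  rw [Finset.mem_convexHull'] at hxT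
  obtain ⟨w, hw0, hw1, hwx⟩ := hxT
  let T' : Finset B := T.subtype (· ∈ B)
  have hT'sum : ∀ g : EuclideanSpace ℝ (Fin d) → ℝ, ∑ i ∈ T', g i = ∑ p ∈ T, g p := fun g =>
    Finset.sum_subtype_of_mem g hTB
  have hT'sum' : ∀ g : EuclideanSpace ℝ (Fin d) → EuclideanSpace ℝ (Fin d),
      ∑ i ∈ T', g i = ∑ p ∈ T, g p := fun g => Finset.sum_subtype_of_mem g hTB
  have hw1' : ∑ i ∈ T', w i = 1 := (hT'sum w).trans hw1
  have hxc : x = T'.affineCombination ℝ b fun i => w i := by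
    rw [Finset.affineCombination_eq_linear_combination _ _ _ hw1', ← hwx]
    exact (hT'sum' fun p => w p • p).symm
  have hnonneg : ∀ i, 0 ≤ b.coord i y := by
    intro i
    rw [← sign_nonneg_iff, ← hsign, sign_nonneg_iff, hxc]
    by_cases hi : i ∈ T'
    · rw [b.coord_apply_combination_of_mem hi hw1']
      exact hw0 i (by simpa [T'] using hi)
    · rw [b.coord_apply_combination_of_notMem hi hw1']
  have hzero : ∀ i ∉ T', b.coord i y = 0 := by
    intro i hi
    rw [← sign_eq_zero_iff, ← hsign, sign_eq_zero_iff, hxc,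
      b.coord_apply_combination_of_notMem hi hw1']
  rw [← b.linear_combination_coord_eq_self y]
  have hsum : ∑ i, b.coord i y • b i = ∑ i ∈ T', b.coord i y • b i :=
    (Finset.sum_subset (Finset.subset_univ T') fun i _ hi => by rw [hzero i hi, zero_smul]).symm
  rw [hsum]
  refine (convex_convexHull ℝ A).sum_mem (fun i _ => hnonneg i) ?_ fun i hi => ?_
  · rw [Finset.sum_subset (Finset.subset_univ T') fun i _ hi => hzero i hi]
    exact b.sum_coord_apply_eq_one y
  · exact subset_convexHull ℝ A (hTA (by simpa [T', hb] using hi))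

/-- The sites may be degenerate; adjoining the `d + 1` points of an affine basis forces spanning. -/
theorem exists_finset_affineSpan_eq_top (s : Fin n → EuclideanSpace ℝ (Fin d)) :
    ∃ Q : Finset (EuclideanSpace ℝ (Fin d)), Set.range s ⊆ Q ∧
      affineSpan ℝ (Q : Set (EuclideanSpace ℝ (Fin d))) = ⊤ ∧ Q.card ≤ n + d + 1 := by
  classical
  obtain ⟨b⟩ := AffineBasis.exists_affineBasis_of_finiteDimensional (ι := Fin (d + 1)) (k := ℝ)
    (P := EuclideanSpace ℝ (Fin d)) (by simp)
  refine ⟨Finset.univ.image s ∪ Finset.univ.image b, ?_, ?_, ?_⟩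
  · simp
  · rw [eq_top_iff, ← b.tot]
    exact affineSpan_mono ℝ (by simp)
  · refine (Finset.card_union_le _ _).trans ?_
    have h1 := Finset.card_image_le (s := Finset.univ) (f := s)
    have h2 := Finset.card_image_le (s := Finset.univ) (f := b)
    simp only [Finset.card_univ, Fintype.card_fin] at h1 h2
    omega

/-- The values of `f` depend only on which subsets of the sites have the argument in their convex
hull. -/
def HullDetermined (s : Fin n → EuclideanSpace ℝ (Fin d)) (f : EuclideanSpace ℝ (Fin d) → ℝ) :
    Prop :=
  ∀ x y, (∀ A ⊆ Set.range s, x ∈ convexHull ℝ A ↔ y ∈ convexHull ℝ A) → f x = f y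

theorem HullDetermined.exists_signVector {s : Fin n → EuclideanSpace ℝ (Fin d)}
    {f : EuclideanSpace ℝ (Fin d) → ℝ} (hf : HullDetermined s f) :
    ∃ Q : Finset (EuclideanSpace ℝ (Fin d)), Q.card ≤ n + d + 1 ∧ ∀ x y,
      signVector (vanishingFn (Q := (Q : Set (EuclideanSpace ℝ (Fin d))))) x =
        signVector vanishingFn y → f x = f y := by
  obtain ⟨Q, hsQ, hspan, hcard⟩ := exists_finset_affineSpan_eq_top s
  refine ⟨Q, hcard, fun x y hxy => hf x y fun A hA => ⟨?_, ?_⟩⟩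
  · exact mem_convexHull_of_signVector_eq Q.finite_toSet hspan (hA.trans hsQ) hxy
  · exact mem_convexHull_of_signVector_eq Q.finite_toSet hspan (hA.trans hsQ) hxy.symm

/-- An upper bound for the complexity of the probability map of `n` sites in `ℝ^d`. -/
def complexityBound (d n : ℕ) : ℕ :=
  (2 * (n + d + 1) ^ d + 1) ^ d

theorem signVector_bound_le {Q : Finset (EuclideanSpace ℝ (Fin d))} (hQ : Q.card ≤ n + d + 1) :
    (((2 * Fintype.card (Fin d → (Q : Set (EuclideanSpace ℝ (Fin d)))) + 1) ^ d : ℕ) : ℕ∞) ≤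
      complexityBound d n := by
  have : Fintype.card (Fin d → (Q : Set (EuclideanSpace ℝ (Fin d)))) = Q.card ^ d := by
    simp
  rw [this, complexityBound]
  norm_cast
  gcongr

theorem HullDetermined.encard_regions_le {s : Fin n → EuclideanSpace ℝ (Fin d)}
    {f : EuclideanSpace ℝ (Fin d) → ℝ} (hf : HullDetermined s f) :
    (regions f).encard ≤ complexityBound d n := by
  obtain ⟨Q, hQ, h⟩ := hf.exists_signVector
  exact (encard_regions_le_of_signVector h).trans (signVector_bound_le hQ)

theorem HullDetermined.encard_faces_le {s : Fin n → EuclideanSpace ℝ (Fin d)}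
    {f : EuclideanSpace ℝ (Fin d) → ℝ} (hf : HullDetermined s f) :
    (faces f).encard ≤ complexityBound d n := by
  obtain ⟨Q, hQ, h⟩ := hf.exists_signVector
  exact (encard_faces_le_of_signVector h).trans (signVector_bound_le hQ)

theorem UnipointInput.hullDetermined (P : UnipointInput d n) :
    HullDetermined P.site P.membershipProb := by
  intro x y h
  unfold membershipProb
  congr 1
  ext B
  simp [h _ (Set.image_subset_range P.site B)]

theorem MultipointInput.existing_subset (P : MultipointInput d n) (o : P.Outcome) :
    P.existing o ⊆ Set.range P.site := by
  rintro _ ⟨k, i, -, rfl⟩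
  exact ⟨_, rfl⟩

theorem MultipointInput.hullDetermined (P : MultipointInput d n) :
    HullDetermined P.site P.membershipProb := by
  intro x y h
  unfold membershipProb
  congr 1
  ext o
  simp [h _ (P.existing_subset o)]

/-! ### Probabilities for which the membership probability determines all hull memberships -/

/-- The number whose binary digits are given by the set `B`. -/
def code (B : Finset (Fin n)) : ℕ :=
  ∑ i ∈ B, 2 ^ (i : ℕ)

theorem code_injective : Function.Injective (code (n := n)) := by
  intro B C h
  have key : ∀ B : Finset (Fin n), code B = ∑ i ∈ B.map Fin.valEmbedding, 2 ^ i := by simp [code]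
  simp only [key] at h
  exact Finset.map_injective _ (Finset.geomSum_injective le_rfl h)

/-- The number whose binary digits are given by the codes of the sets in `F`. -/
def familyCode (F : Finset (Finset (Fin n))) : ℕ :=
  ∑ B ∈ F, 2 ^ code B

theorem familyCode_injective : Function.Injective (familyCode (n := n)) := by
  intro F G h
  have key : ∀ F : Finset (Finset (Fin n)),
      familyCode F = ∑ c ∈ F.map ⟨_, code_injective⟩, 2 ^ c := by simp [familyCode]
  simp only [key] at h
  exact Finset.map_injective _ (Finset.geomSum_injective le_rfl h)

/-- The unipoint input with the given sites whose `i`-th site exists with odds `2 ^ 2 ^ i`. -/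
noncomputable def separatingInput (s : Fin n → EuclideanSpace ℝ (Fin d))
    (hs : Function.Injective s) : UnipointInput d n where
  site := s
  site_injective := hs
  prob i := 2 ^ 2 ^ (i : ℕ) * (1 + 2 ^ 2 ^ (i : ℕ))⁻¹
  prob_pos i := by positivity
  prob_le_one i := by
    rw [← div_eq_mul_inv]
    exact (div_le_one (by positivity)).2 (by linarith)

-- Dividing by the probability of the empty outcome turns the weight of `B` into the product of its
-- odds, `2 ^ code B`; summing over the family gives `familyCode`.
open Classical in
theorem separatingInput_membershipProb (s : Fin n → EuclideanSpace ℝ (Fin d))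
    (hs : Function.Injective s) (q : EuclideanSpace ℝ (Fin d)) :
    (separatingInput s hs).membershipProb q =
      (familyCode (Finset.univ.filter fun B : Finset (Fin n) =>
        q ∈ convexHull ℝ (s '' (B : Set (Fin n)))) : ℝ) * ∏ i : Fin n, (1 + 2 ^ 2 ^ (i : ℕ) : ℝ)⁻¹ := by
  unfold UnipointInput.membershipProb familyCode
  rw [Nat.cast_sum, Finset.sum_mul]
  refine Finset.sum_congr rfl fun B _ => ?_
  have h1 : ∀ i : Fin n, 1 - (separatingInput s hs).prob i = (1 + 2 ^ 2 ^ (i : ℕ) : ℝ)⁻¹ := by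
    intro i
    have : (1 + 2 ^ 2 ^ (i : ℕ) : ℝ) ≠ 0 := by positivity
    simp only [separatingInput]
    field_simp
    ring
  have h2 : ∀ i : Fin n, (separatingInput s hs).prob i =
      2 ^ 2 ^ (i : ℕ) * (1 + 2 ^ 2 ^ (i : ℕ) : ℝ)⁻¹ := fun _ => rfl
  simp only [h1]
  simp only [h2, Finset.prod_mul_distrib]
  rw [mul_assoc, Finset.prod_mul_prod_compl, Finset.prod_pow_eq_pow_sum, Nat.cast_pow,
    Nat.cast_ofNat, code]

theorem mem_convexHull_iff_of_membershipProb_eq {s : Fin n → EuclideanSpace ℝ (Fin d)}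
    (hs : Function.Injective s) {x y : EuclideanSpace ℝ (Fin d)}
    (h : (separatingInput s hs).membershipProb x = (separatingInput s hs).membershipProb y)
    (B : Finset (Fin n)) :
    x ∈ convexHull ℝ (s '' (B : Set (Fin n))) ↔ y ∈ convexHull ℝ (s '' (B : Set (Fin n))) := by
  classical
  rw [separatingInput_membershipProb, separatingInput_membershipProb] at h
  have hC : (∏ i : Fin n, (1 + 2 ^ 2 ^ (i : ℕ) : ℝ)⁻¹) ≠ 0 :=
    Finset.prod_ne_zero_iff.2 fun i _ => by positivity
  have h' := familyCode_injective (Nat.cast_inj.1 (mul_right_cancel₀ hC h))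
  have := congrArg (B ∈ ·) h'
  simpa using this

/-! ### The multipoint model contains the unipoint model -/

/-- A unipoint input, viewed as a multipoint input in which every site has its own uncertain
point. -/
def UnipointInput.toMultipoint (P : UnipointInput d n) : MultipointInput d n where
  m := n
  owner := id
  site := P.site
  site_injective := P.site_injective
  prob := P.prob
  prob_pos := P.prob_pos
  prob_le_one := P.prob_le_one
  sum_prob_le_one k := by
    simpa [Finset.filter_eq'] using P.prob_le_one k

open Classical in
/-- The outcome of `P.toMultipoint` in which exactly the sites in `B` exist. -/
noncomputable def UnipointInput.outcome (P : UnipointInput d n) (B : Finset (Fin n)) :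
    P.toMultipoint.Outcome :=
  fun k : Fin n => if k ∈ B then some ⟨k, rfl⟩ else none

theorem UnipointInput.outcome_of_mem (P : UnipointInput d n) {B : Finset (Fin n)} {k : Fin n}
    (hk : k ∈ B) : P.outcome B k = some ⟨k, rfl⟩ :=
  if_pos hk

theorem UnipointInput.outcome_of_notMem (P : UnipointInput d n) {B : Finset (Fin n)} {k : Fin n}
    (hk : k ∉ B) : P.outcome B k = none :=
  if_neg hk

theorem UnipointInput.outcome_bijective (P : UnipointInput d n) :
    Function.Bijective P.outcome := by
  classical
  refine ⟨fun B C h => ?_, fun o => ⟨Finset.univ.filter fun k : Fin n => (o k).isSome, ?_⟩⟩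
  · ext k
    have hk : P.outcome B k = P.outcome C k := by rw [h]
    by_cases hB : k ∈ B <;> by_cases hC : k ∈ C
    · simp [hB, hC]
    · rw [P.outcome_of_mem hB, P.outcome_of_notMem hC] at hk
      cases hk
    · rw [P.outcome_of_notMem hB, P.outcome_of_mem hC] at hk
      cases hk
    · simp [hB, hC]
  · refine funext fun k : Fin n => ?_
    rcases h : o k with _ | ⟨i, hi⟩
    · rw [P.outcome_of_notMem (Finset.mem_filter.not.2 fun h' => by simp [h] at h')]
    · have hi' : i = k := hi
      subst hi'
      rw [P.outcome_of_mem (Finset.mem_filter.2 ⟨Finset.mem_univ _, by simp [h]⟩)]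

theorem UnipointInput.existing_outcome (P : UnipointInput d n) (B : Finset (Fin n)) :
    P.toMultipoint.existing (P.outcome B) = P.site '' (B : Set (Fin n)) := by
  ext x
  constructor
  · rintro ⟨k, ⟨i, hi⟩, ho, rfl⟩
    refine ⟨i, ?_, rfl⟩
    have hi' : i = k := hi
    subst hi'
    by_contra hB
    rw [P.outcome_of_notMem hB] at ho
    cases ho
  · rintro ⟨i, hi, rfl⟩
    exact ⟨i, ⟨i, rfl⟩, P.outcome_of_mem hi, rfl⟩

theorem UnipointInput.membershipProb_toMultipoint (P : UnipointInput d n) :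
    P.toMultipoint.membershipProb = P.membershipProb := by
  classical
  funext q
  unfold MultipointInput.membershipProb UnipointInput.membershipProb
  rw [Finset.sum_filter, Finset.sum_filter]
  refine (Fintype.sum_bijective P.outcome P.outcome_bijective _ _ fun B => ?_).symm
  rw [P.existing_outcome]
  congr 1
  have hprod : ∏ k, P.toMultipoint.choiceProb k (P.outcome B k) =
      ∏ i : Fin n, if i ∈ B then P.prob i else 1 - P.prob i := by
    refine Finset.prod_congr rfl fun (k : Fin n) _ => ?_
    by_cases h : k ∈ B
    · rw [P.outcome_of_mem h, if_pos h]
      rfl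
    · rw [P.outcome_of_notMem h, if_neg h]
      change 1 - ∑ i with i = k, P.prob i = 1 - P.prob k
      simp [Finset.filter_eq']
  rw [hprod, Finset.prod_ite, Finset.filter_mem_eq_inter, Finset.univ_inter]
  congr 2
  ext i
  simp

/-! ### Sites whose simplices form a grid of intersection points -/

/-- The smallest differing exponent dominates: its term exceeds `ε ^ (e k₀ + 1)` because `c k₀ > ε`,
while the opposing terms have larger exponents and total weight at most `1`. -/
theorem sum_mul_pow_lt {ι : Type*} [Fintype ι] {c : ι → ℝ} {ε : ℝ} (h0 : 0 < ε) (h1 : ε < 1)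
    (hc : ∀ k, ε < c k) (hsum : ∑ k, c k = 1) {e f : ι → ℕ} {k₀ : ι} (hk₀ : e k₀ < f k₀)
    (hmin : ∀ k, e k ≠ f k → e k₀ ≤ e k ∧ e k₀ ≤ f k) (hef : ∀ k l, e k = f l → k = l) :
    ∑ k, c k * ε ^ f k < ∑ k, c k * ε ^ e k := by
  classical
  have hterm : ∀ k, (if k = k₀ then c k * ε ^ e k₀ else 0) - c k * ε ^ (e k₀ + 1) ≤
      c k * ε ^ e k - c k * ε ^ f k := by
    intro k
    have hck : 0 ≤ c k := (h0.trans (hc k)).le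
    have hpow : ∀ a : ℕ, 0 < ε ^ a := fun a => pow_pos h0 a
    split_ifs with h
    · subst h
      have : ε ^ f k ≤ ε ^ (e k + 1) := pow_le_pow_of_le_one h0.le h1.le hk₀
      nlinarith [mul_le_mul_of_nonneg_left this hck]
    · by_cases hne : e k = f k
      · rw [hne]
        nlinarith [mul_nonneg hck (hpow (e k₀ + 1)).le]
      · have hf : e k₀ + 1 ≤ f k := by
          have h2 := (hmin k hne).2
          have h3 : e k₀ ≠ f k := fun h' => h (hef _ _ h').symm
          omega
        have : ε ^ f k ≤ ε ^ (e k₀ + 1) := pow_le_pow_of_le_one h0.le h1.le hf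
        nlinarith [mul_le_mul_of_nonneg_left this hck, mul_nonneg hck (hpow (e k)).le]
  have := Finset.sum_le_sum fun k (_ : k ∈ Finset.univ) => hterm k
  rw [Finset.sum_sub_distrib, Finset.sum_sub_distrib, Finset.sum_ite_eq' Finset.univ k₀,
    ← Finset.sum_mul, hsum, if_pos (Finset.mem_univ _), pow_succ] at this
  nlinarith [mul_pos (sub_pos.2 (hc k₀)) (pow_pos h0 (e k₀))]

theorem eq_of_sum_mul_pow_eq {ι : Type*} [Fintype ι] {c : ι → ℝ} {ε : ℝ} (h0 : 0 < ε)
    (h1 : ε < 1) (hc : ∀ k, ε < c k) (hsum : ∑ k, c k = 1) {e f : ι → ℕ}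
    (hef : ∀ k l, e k = f l → k = l) (h : ∑ k, c k * ε ^ e k = ∑ k, c k * ε ^ f k) : e = f := by
  classical
  by_contra hne
  have hD : (Finset.univ.filter fun k => e k ≠ f k).Nonempty := by
    obtain ⟨k, hk⟩ := Function.ne_iff.1 hne
    exact ⟨k, by simpa using hk⟩
  obtain ⟨k₀, hk₀, hmin⟩ := Finset.exists_min_image _ (fun k => min (e k) (f k)) hD
  simp only [Finset.mem_filter, Finset.mem_univ, true_and] at hk₀ hmin
  rcases lt_or_gt_of_ne hk₀ with hlt | hlt
  · refine (sum_mul_pow_lt h0 h1 hc hsum hlt (fun k hk => ?_) hef).ne' h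
    have := hmin k hk
    omega
  · refine (sum_mul_pow_lt h0 h1 hc hsum hlt (fun k hk => ?_)
      fun k l hkl => (hef l k hkl.symm).symm).ne h
    have := hmin k hk.symm
    omega

/-- The scale of the construction. -/
noncomputable def scale (d : ℕ) : ℝ :=
  1 / (8 * d)

/-- The `k`-th barycentric coordinate, with respect to the simplex with vertices
`e_k` (`k ≠ j`) and `-∑ k ≠ j, e_k`, of the projection of `x` to the hyperplane `x_j = 0`. -/
noncomputable def weight (j : Fin d) (x : Fin d → ℝ) (k : Fin d) : ℝ :=
  (if k = j then 0 else x k) + (1 - ∑ l, if l = j then 0 else x l) / d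

theorem sum_weight (hd : 1 ≤ d) (j : Fin d) (x : Fin d → ℝ) : ∑ k, weight j x k = 1 := by
  have : (d : ℝ) ≠ 0 := by positivity
  simp only [weight, Finset.sum_add_distrib, Finset.sum_const, Finset.card_univ, Fintype.card_fin,
    nsmul_eq_mul]
  field_simp
  ring

theorem abs_sum_ite_le {j : Fin d} {x : Fin d → ℝ} {δ : ℝ} (hδ : 0 ≤ δ) (hx : ∀ l, |x l| ≤ δ) :
    |∑ l, if l = j then 0 else x l| ≤ d * δ := by
  refine (Finset.abs_sum_le_sum_abs _ _).trans ?_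
  have : ∀ l ∈ Finset.univ, |if l = j then 0 else x l| ≤ δ := by
    intro l _
    split_ifs
    · simpa using hδ
    · exact hx l
  refine (Finset.sum_le_card_nsmul _ _ _ this).trans (by simp)

/-- Near the origin the weights stay close to `1 / d = 8 * scale d`. They are thus positive and
exceed the ratio `scale d` of consecutive heights, as `eq_of_sum_mul_pow_eq` requires. -/
theorem le_weight (hd : 1 ≤ d) (j : Fin d) {x : Fin d → ℝ} (hx : ∀ l, |x l| ≤ 2 * scale d)
    (k : Fin d) : 4 * scale d ≤ weight j x k := by
  have hd' : (0 : ℝ) < d := by exact_mod_cast hd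
  have hs : (d : ℝ) * scale d = 1 / 8 := by
    unfold scale
    field_simp
  have hs0 : 0 < scale d := by
    unfold scale
    positivity
  have h1 := abs_le.1 (abs_sum_ite_le (j := j) (by positivity) hx)
  have h2 : -(2 * scale d) ≤ if k = j then 0 else x k := by
    split_ifs
    · linarith
    · exact (abs_le.1 (hx k)).1
  have h3 : 6 * scale d ≤ (1 - ∑ l, if l = j then 0 else x l) / d := by
    rw [le_div_iff₀ hd']
    nlinarith [h1.2]
  unfold weight
  linarith

/-- The linear part of `weight`. -/
noncomputable def weightLinear (j k : Fin d) (x : Fin d → ℝ) : ℝ :=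
  (if k = j then 0 else x k) - (∑ l, if l = j then 0 else x l) / d

theorem weight_eq (j : Fin d) (x : Fin d → ℝ) (k : Fin d) :
    weight j x k = weightLinear j k x + 1 / d := by
  unfold weight weightLinear
  ring

theorem weightLinear_add (j k : Fin d) (x y : Fin d → ℝ) :
    weightLinear j k (x + y) = weightLinear j k x + weightLinear j k y := by
  have : ∀ l, (if l = j then 0 else x l + y l) =
      (if l = j then 0 else x l) + (if l = j then 0 else y l) := by
    intro l
    split_ifs <;> simp
  simp only [weightLinear, Pi.add_apply, this, Finset.sum_add_distrib]
  ring

theorem weightLinear_smul (j k : Fin d) (a : ℝ) (x : Fin d → ℝ) :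
    weightLinear j k (a • x) = a * weightLinear j k x := by
  have : ∀ l, (if l = j then 0 else a * x l) = a * (if l = j then 0 else x l) := by
    intro l
    split_ifs <;> simp
  simp only [weightLinear, Pi.smul_apply, smul_eq_mul, this, ← Finset.mul_sum]
  ring

theorem abs_weightLinear_le (hd : 1 ≤ d) (j k : Fin d) (x : Fin d → ℝ) :
    |weightLinear j k x| ≤ 2 * ‖x‖ := by
  have hd' : (0 : ℝ) < d := by exact_mod_cast hd
  have hx : ∀ l, |x l| ≤ ‖x‖ := fun l => norm_le_pi_norm x l
  have h1 := abs_sum_ite_le (j := j) (norm_nonneg x) hx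
  have h2 : |if k = j then 0 else x k| ≤ ‖x‖ := by
    split_ifs
    · simp
    · exact hx k
  have h3 : |(∑ l, if l = j then 0 else x l) / d| ≤ ‖x‖ := by
    rw [abs_div, abs_of_pos hd', div_le_iff₀ hd']
    linarith
  have := abs_sub (if k = j then 0 else x k) ((∑ l, if l = j then 0 else x l) / d)
  unfold weightLinear
  linarith

/-- The hyperplanes `x_j = ∑ k, weight j x k * t j k` have a common point near the origin. -/
theorem exists_common_point (hd : 1 ≤ d) (t : Fin d → Fin d → ℝ)
    (ht : ∀ j k, |t j k| ≤ scale d) :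
    ∃ x : Fin d → ℝ, (∀ l, |x l| ≤ 2 * scale d) ∧ ∀ j, x j = ∑ k, weight j x k * t j k := by
  have hd' : (0 : ℝ) < d := by exact_mod_cast hd
  have hs : (d : ℝ) * scale d = 1 / 8 := by
    unfold scale
    field_simp
  have hs0 : 0 < scale d := by
    unfold scale
    positivity
  let T : (Fin d → ℝ) →ₗ[ℝ] (Fin d → ℝ) :=
    { toFun := fun x j => x j - ∑ k, weightLinear j k x * t j k
      map_add' := fun x y => by
        funext j
        simp only [weightLinear_add, add_mul, Finset.sum_add_distrib, Pi.add_apply]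
        ring
      map_smul' := fun a x => by
        funext j
        simp only [weightLinear_smul, mul_assoc, ← Finset.mul_sum, Pi.smul_apply, smul_eq_mul,
          RingHom.id_apply]
        ring }
  -- `T` is the identity minus a map of sup-norm at most `d * 2 * scale d = 1 / 4`, hence
  -- invertible.
  have hbound : ∀ x, ‖x‖ ≤ ‖T x‖ + ‖x‖ / 4 := by
    intro x
    refine (pi_norm_le_iff_of_nonneg (by positivity)).2 fun j => ?_
    have h1 : |T x j| ≤ ‖T x‖ := norm_le_pi_norm (T x) j
    have h2 : |∑ k, weightLinear j k x * t j k| ≤ ‖x‖ / 4 := by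
      refine (Finset.abs_sum_le_sum_abs _ _).trans ?_
      have : ∀ k ∈ Finset.univ, |weightLinear j k x * t j k| ≤ 2 * ‖x‖ * scale d := by
        intro k _
        rw [abs_mul]
        exact mul_le_mul (abs_weightLinear_le hd j k x) (ht j k) (abs_nonneg _) (by positivity)
      refine (Finset.sum_le_card_nsmul _ _ _ this).trans (le_of_eq ?_)
      simp only [Finset.card_univ, Fintype.card_fin, nsmul_eq_mul]
      linear_combination 2 * ‖x‖ * hs
    have h3 : x j = T x j + ∑ k, weightLinear j k x * t j k := by simp [T]
    rw [Real.norm_eq_abs, h3]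
    exact (abs_add_le _ _).trans (add_le_add h1 h2)
  have hinj : Function.Injective T := by
    rw [← LinearMap.ker_eq_bot, LinearMap.ker_eq_bot']
    intro x hx
    have := hbound x
    rw [hx, norm_zero] at this
    exact norm_le_zero_iff.1 (by linarith [norm_nonneg x])
  -- The right-hand side comes from the constant part `1 / d` of the weights.
  obtain ⟨x, hx⟩ := (LinearMap.injective_iff_surjective.1 hinj) fun j => ∑ k, 1 / d * t j k
  have hTx : ‖T x‖ ≤ scale d := by
    rw [hx]
    refine (pi_norm_le_iff_of_nonneg hs0.le).2 fun j => ?_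
    refine (Finset.abs_sum_le_sum_abs _ _).trans ?_
    have : ∀ k ∈ Finset.univ, |1 / (d : ℝ) * t j k| ≤ 1 / d * scale d := by
      intro k _
      rw [abs_mul, abs_of_pos (by positivity)]
      exact mul_le_mul_of_nonneg_left (ht j k) (by positivity)
    refine (Finset.sum_le_card_nsmul _ _ _ this).trans (le_of_eq ?_)
    simp only [Finset.card_univ, Fintype.card_fin, nsmul_eq_mul]
    field_simp
  refine ⟨x, fun l => ?_, fun j => ?_⟩
  · have h1 : |x l| ≤ ‖x‖ := norm_le_pi_norm x l
    linarith [hbound x]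
  · have h1 : x j - ∑ k, weightLinear j k x * t j k = ∑ k, 1 / d * t j k := congrFun hx j
    simp only [weight_eq, add_mul, Finset.sum_add_distrib]
    linarith

/-- The `k`-th vertex of a simplex near the hyperplane `x_j = 0`, raised to height `t`. -/
noncomputable def vertex (j k : Fin d) (t : ℝ) : EuclideanSpace ℝ (Fin d) :=
  WithLp.toLp 2 fun l => if l = j then t else if k = j then -1 else if l = k then 1 else 0

theorem vertex_apply (j k : Fin d) (t : ℝ) (l : Fin d) :
    vertex j k t l = if l = j then t else if k = j then -1 else if l = k then 1 else 0 := rfl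

theorem sum_weight_smul_vertex (j : Fin d) (t : Fin d → ℝ)
    {x : EuclideanSpace ℝ (Fin d)} (hx : x j = ∑ k, weight j x k * t k) :
    ∑ k, weight j x k • vertex j k (t k) = x := by
  ext l
  simp only [WithLp.ofLp_sum, WithLp.ofLp_smul, Finset.sum_apply, Pi.smul_apply, smul_eq_mul,
    vertex_apply]
  by_cases hl : l = j
  · subst hl
    simp [← hx]
  · have : ∀ k, weight j x k * (if k = j then -1 else if l = k then 1 else 0 : ℝ) =
        (if k = l then weight j x k else 0) - (if k = j then weight j x k else 0) := by
      intro k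
      by_cases h : k = j
      · subst h
        simp [Ne.symm hl]
      · simp [h, eq_comm]
    simp only [hl, if_false, this, Finset.sum_sub_distrib, Finset.sum_ite_eq', Finset.mem_univ,
      if_true]
    -- In `weight l - weight j` the averaging terms cancel, leaving `x l`.
    simp [weight, hl]

theorem weight_vertex (hd : 1 ≤ d) (j k k' : Fin d) (t : ℝ) :
    weight j (vertex j k t) k' = if k' = k then 1 else 0 := by
  have hd' : (d : ℝ) ≠ 0 := by positivity
  have hsum : (∑ l, if l = j then 0 else vertex j k t l) = if k = j then 1 - (d : ℝ) else 1 := by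
    simp only [vertex_apply]
    by_cases h : k = j
    · subst h
      have : ∀ l, (if l = k then 0 else if l = k then t else if k = k then (-1 : ℝ) else
          if l = k then 1 else 0) = (if l = k then 1 else 0) - 1 := by
        intro l
        by_cases hl : l = k <;> simp [hl]
      rw [Finset.sum_congr rfl fun l _ => this l, Finset.sum_sub_distrib]
      simp
    · have : ∀ l, (if l = j then 0 else if l = j then t else if k = j then (-1 : ℝ) else
          if l = k then 1 else 0) = if l = k then 1 else 0 := by
        intro l
        by_cases hl : l = j
        · subst hl
          simp [Ne.symm h]
        · simp [hl, h]
      simp only [this]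
      simp [h]
  unfold weight
  rw [hsum]
  simp only [vertex_apply]
  by_cases h : k = j
  · subst h
    by_cases h' : k' = k
    · simp [h', hd']
    · simp [h', hd']
  · by_cases h' : k' = j
    · subst h'
      simp [h, Ne.symm h]
    · simp [h, h']

/-- The equation is affine in `x` and holds at each vertex, where the weights form an indicator. -/
theorem eq_sum_of_mem_convexHull_vertex (hd : 1 ≤ d) (j : Fin d) (t : Fin d → ℝ)
    {x : EuclideanSpace ℝ (Fin d)}
    (hx : x ∈ convexHull ℝ (Set.range fun k => vertex j k (t k))) :
    x j = ∑ k, weight j x k * t k := by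
  have hconv : Convex ℝ {x : EuclideanSpace ℝ (Fin d) | x j = ∑ k, weight j x k * t k} := by
    intro x hx y hy a b _ _ hab
    simp only [Set.mem_ofPred_eq] at hx hy ⊢
    have hw : ∀ k, weight j (a • x + b • y).ofLp k = a * weight j x k + b * weight j y k := by
      intro k
      simp only [weight_eq, WithLp.ofLp_add, WithLp.ofLp_smul, weightLinear_add, weightLinear_smul]
      linear_combination (-(1 / (d : ℝ))) * hab
    simp only [hw, add_mul, Finset.sum_add_distrib, mul_assoc, ← Finset.mul_sum, ← hx, ← hy]
    simp
  refine convexHull_min ?_ hconv hx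
  rintro _ ⟨k, rfl⟩
  simp [weight_vertex hd, vertex_apply]

theorem scale_pos (hd : 1 ≤ d) : 0 < scale d := by
  unfold scale
  positivity

theorem scale_lt_one (hd : 1 ≤ d) : scale d < 1 := by
  have hd' : (1 : ℝ) ≤ d := by exact_mod_cast hd
  unfold scale
  rw [div_lt_one (by positivity)]
  linarith

/-- Site `i` is a vertex of type `(i % d, i / d % d)`, raised to the height `scale d ^ (i + 1)`. -/
noncomputable def gridSite (hd : 1 ≤ d) (i : Fin n) : EuclideanSpace ℝ (Fin d) :=
  vertex ⟨i % d, Nat.mod_lt _ hd⟩ ⟨i / d % d, Nat.mod_lt _ hd⟩ (scale d ^ ((i : ℕ) + 1))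

theorem gridSite_injective (hd : 1 ≤ d) : Function.Injective (gridSite (n := n) hd) := by
  intro a b h
  have h0 := scale_pos hd
  have h1 := scale_lt_one hd
  have hpos : 0 < scale d ^ ((a : ℕ) + 1) := pow_pos h0 _
  have hlt : scale d ^ ((a : ℕ) + 1) < 1 := pow_lt_one₀ h0.le h1 (by omega)
  have hj := congrArg (fun v : EuclideanSpace ℝ (Fin d) => v ⟨a % d, Nat.mod_lt _ hd⟩) h
  simp only [gridSite, vertex_apply, if_true] at hj
  -- The first site has a height strictly between `0` and `1` here, so the other entry cannot be
  -- `-1`, `0` or `1`; it is a height too, and equal powers have equal exponents.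
  split_ifs at hj
  · have := pow_right_injective₀ h0 h1.ne hj
    exact Fin.ext (by omega)
  all_goals linarith

/-- The index of the `m`-th site of type `(j, k)`. -/
def siteIndex (j k : Fin d) (m : Fin (n / (d * d))) : Fin n :=
  ⟨j + d * (k + d * m), by
    have hm : (m : ℕ) + 1 ≤ n / (d * d) := m.2
    have h1 : d * d * (m + 1) ≤ n := (Nat.mul_le_mul_left _ hm).trans (Nat.mul_div_le n (d * d))
    have h2 : d * ((k : ℕ) + 1) ≤ d * d := Nat.mul_le_mul_left _ k.2
    have h3 := j.2
    nlinarith⟩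

theorem siteIndex_mod (j k : Fin d) (m : Fin (n / (d * d))) :
    (siteIndex j k m : ℕ) % d = j := by
  simp [siteIndex, Nat.mod_eq_of_lt j.2]

theorem siteIndex_div (j k : Fin d) (m : Fin (n / (d * d))) :
    (siteIndex j k m : ℕ) / d = k + d * m := by
  have hd : 0 < d := j.pos
  simp [siteIndex, Nat.add_mul_div_left _ _ hd, Nat.div_eq_of_lt j.2]

theorem siteIndex_div_mod (j k : Fin d) (m : Fin (n / (d * d))) :
    (siteIndex j k m : ℕ) / d % d = k := by
  rw [siteIndex_div]
  simp [Nat.mod_eq_of_lt k.2]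

theorem siteIndex_injective (j k : Fin d) :
    Function.Injective (siteIndex (n := n) j k) := by
  intro a b h
  have hd : 0 < d := j.pos
  have h1 := siteIndex_div j k a
  rw [h, siteIndex_div] at h1
  have h2 : d * (b : ℕ) = d * a := by omega
  exact Fin.ext (Nat.eq_of_mul_eq_mul_left hd h2).symm

theorem gridSite_siteIndex (hd : 1 ≤ d) (j k : Fin d) (m : Fin (n / (d * d))) :
    gridSite hd (siteIndex j k m) = vertex j k (scale d ^ ((siteIndex j k m : ℕ) + 1)) := by
  unfold gridSite
  congr 1
  · exact Fin.ext (siteIndex_mod j k m)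
  · exact Fin.ext (siteIndex_div_mod j k m)

/-- The sites of a simplex of the `j`-th group: for each `k`, the site number `m k` of type
`(j, k)`. -/
def simplexSites (j : Fin d) (m : Fin d → Fin (n / (d * d))) : Finset (Fin n) :=
  Finset.univ.image fun k => siteIndex j k (m k)

theorem image_simplexSites (hd : 1 ≤ d) (j : Fin d) (m : Fin d → Fin (n / (d * d))) :
    gridSite hd '' (simplexSites j m : Set (Fin n)) =
      Set.range fun k => vertex j k (scale d ^ ((siteIndex j k (m k) : ℕ) + 1)) := by
  unfold simplexSites
  rw [Finset.coe_image, Finset.coe_univ, Set.image_univ, ← Set.range_comp]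
  simp only [Function.comp_def, gridSite_siteIndex]

/-- Near the origin, distinct simplices of the same group are disjoint. -/
theorem eq_of_mem_convexHull_simplexSites (hd : 1 ≤ d) {j : Fin d}
    {m m' : Fin d → Fin (n / (d * d))} {x : EuclideanSpace ℝ (Fin d)}
    (hx : ∀ l, |x l| ≤ 2 * scale d)
    (hm : x ∈ convexHull ℝ (gridSite hd '' (simplexSites j m : Set (Fin n))))
    (hm' : x ∈ convexHull ℝ (gridSite hd '' (simplexSites j m' : Set (Fin n)))) : m = m' := by
  rw [image_simplexSites] at hm hm'
  have h := (eq_sum_of_mem_convexHull_vertex hd j _ hm).symm.trans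
    (eq_sum_of_mem_convexHull_vertex hd j _ hm')
  have h0 := scale_pos hd
  have := eq_of_sum_mul_pow_eq h0 (scale_lt_one hd)
    (fun k => lt_of_lt_of_le (by linarith) (le_weight hd j hx k)) (sum_weight hd j x)
    (fun k l hkl => ?_) h
  · funext k
    have hk := congrFun this k
    exact siteIndex_injective j k (Fin.ext (by omega))
  -- Equal exponents mean the same site, whose second base-`d` digit recovers the cluster.
  · have hkl' : (siteIndex j k (m k) : ℕ) = siteIndex j l (m' l) := by omega
    have := siteIndex_div_mod j k (m k)
    rw [hkl', siteIndex_div_mod] at this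
    exact Fin.ext this.symm

theorem exists_mem_convexHull_simplexSites (hd : 1 ≤ d)
    (m : Fin d → Fin d → Fin (n / (d * d))) :
    ∃ x : EuclideanSpace ℝ (Fin d), (∀ l, |x l| ≤ 2 * scale d) ∧
      ∀ j, x ∈ convexHull ℝ (gridSite hd '' (simplexSites j (m j) : Set (Fin n))) := by
  have h0 := scale_pos hd
  have h1 := scale_lt_one hd
  obtain ⟨x, hx, hxm⟩ := exists_common_point hd
    (fun j k => scale d ^ ((siteIndex j k (m j k) : ℕ) + 1)) fun j k => by
      rw [abs_of_pos (pow_pos h0 _)]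
      exact pow_le_of_le_one h0.le h1.le (by omega)
  refine ⟨WithLp.toLp 2 x, hx, fun j => ?_⟩
  rw [image_simplexSites, ← sum_weight_smul_vertex j _ (x := WithLp.toLp 2 x) (hxm j)]
  refine (convex_convexHull ℝ _).sum_mem (fun k _ => ?_) (sum_weight hd j x)
    fun k _ => subset_convexHull ℝ _ ⟨k, rfl⟩
  exact le_trans (by positivity) (le_weight hd j hx k)

/-- If the common points of two choices had equal probability, the first would lie in every simplex
of the second choice, and disjointness within each group would force the choices to agree. -/
theorem le_encard_range_membershipProb (hd : 1 ≤ d) (n : ℕ) :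
    (((n / (d * d)) ^ d ^ 2 : ℕ) : ℕ∞) ≤
      (Set.range (separatingInput (gridSite (n := n) hd)
        (gridSite_injective hd)).membershipProb).encard := by
  choose x hx hxm using exists_mem_convexHull_simplexSites (n := n) hd
  have hinj : Function.Injective fun m : Fin d → Fin d → Fin (n / (d * d)) =>
      (separatingInput (gridSite (n := n) hd) (gridSite_injective hd)).membershipProb (x m) := by
    intro m m' h
    funext j
    have := (mem_convexHull_iff_of_membershipProb_eq (gridSite_injective hd) h
      (simplexSites j (m' j))).2 (hxm m' j)
    exact eq_of_mem_convexHull_simplexSites hd (hx m) (hxm m j) this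
  calc (((n / (d * d)) ^ d ^ 2 : ℕ) : ℕ∞)
      = (Set.univ : Set (Fin d → Fin d → Fin (n / (d * d)))).encard := by
        rw [Set.encard_univ, ENat.card_eq_coe_fintype_card]
        simp [← pow_mul, sq]
    _ = (Set.range _).encard := by rw [← Set.image_univ, hinj.encard_image]
    _ ≤ _ := Set.encard_le_encard (by
        rintro _ ⟨m, rfl⟩
        exact ⟨x m, rfl⟩)

/-! ### Asymptotics -/

theorem isThetaPow_of_bounds (hd : 1 ≤ d) {W : ℕ → ℕ∞} (hu : ∀ n, W n ≤ complexityBound d n)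
    (hl : ∀ n, (((n / (d * d)) ^ d ^ 2 : ℕ) : ℕ∞) ≤ W n) : IsThetaPow W (d ^ 2) := by
  have htop : ∀ n, W n ≠ ⊤ := fun n => ne_top_of_le_ne_top (ENat.natCast_ne_top _) (hu n)
  have hu' : ∀ n, (W n).toNat ≤ complexityBound d n := fun n => ENat.toNat_le_of_le_natCast (hu n)
  have hl' : ∀ n, (n / (d * d)) ^ d ^ 2 ≤ (W n).toNat := fun n => by
    have := hl n
    rw [← ENat.natCast_toNat (htop n)] at this
    exact_mod_cast this
  refine ⟨htop, ?_, ?_⟩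
  · refine IsBigO.of_bound ((3 ^ d * (d + 2) ^ d ^ 2 : ℕ) : ℝ) ?_
    filter_upwards [eventually_ge_atTop 1] with n hn
    rw [Real.norm_of_nonneg (by positivity), Real.norm_of_nonneg (by positivity)]
    have h1 : n + d + 1 ≤ (d + 2) * n := by nlinarith
    have h2 : 2 * (n + d + 1) ^ d + 1 ≤ 3 * ((d + 2) * n) ^ d := by
      have h3 := Nat.pow_le_pow_left h1 d
      have h4 : 1 ≤ ((d + 2) * n) ^ d := Nat.one_le_pow _ _ (by positivity)
      omega
    have h5 : complexityBound d n ≤ 3 ^ d * (d + 2) ^ d ^ 2 * n ^ d ^ 2 := by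
      refine (Nat.pow_le_pow_left h2 d).trans (le_of_eq ?_)
      rw [mul_pow, ← pow_mul, ← sq, mul_pow]
      ring
    exact_mod_cast (hu' n).trans h5
  · refine IsBigO.of_bound (((2 * (d * d)) ^ d ^ 2 : ℕ) : ℝ) ?_
    filter_upwards [eventually_ge_atTop (d * d)] with n hn
    rw [Real.norm_of_nonneg (by positivity), Real.norm_of_nonneg (by positivity)]
    have hdd : 0 < d * d := by positivity
    -- Rounding down loses at most a factor `2` once the quotient is at least `1`.
    have h1 : n ≤ 2 * (d * d) * (n / (d * d)) := by
      have h2 := Nat.div_add_mod n (d * d)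
      have h3 := Nat.mod_lt n hdd
      have h4 : 1 ≤ n / (d * d) := (Nat.one_le_div_iff hdd).2 hn
      nlinarith
    have h5 : n ^ d ^ 2 ≤ (2 * (d * d)) ^ d ^ 2 * (W n).toNat := by
      refine (Nat.pow_le_pow_left h1 _).trans ?_
      rw [mul_pow]
      exact Nat.mul_le_mul_left _ (hl' n)
    exact_mod_cast h5

end UncertainHull

open UncertainHull

theorem mainTheorem4 (d : ℕ) (hd : 1 ≤ d) :
    UncertainHull.IsThetaPow (fun n => UncertainHull.worstRegionsUnipoint d n) (d ^ 2) ∧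
    UncertainHull.IsThetaPow (fun n => UncertainHull.worstFacesUnipoint d n) (d ^ 2) ∧
    UncertainHull.IsThetaPow (fun n => UncertainHull.worstRegionsMultipoint d n) (d ^ 2) ∧
    UncertainHull.IsThetaPow (fun n => UncertainHull.worstFacesMultipoint d n) (d ^ 2) := by
  have hl := fun n => le_encard_range_membershipProb hd n
  refine ⟨isThetaPow_of_bounds hd (fun n => ?_) fun n => ?_,
    isThetaPow_of_bounds hd (fun n => ?_) fun n => ?_,
    isThetaPow_of_bounds hd (fun n => ?_) fun n => ?_,
    isThetaPow_of_bounds hd (fun n => ?_) fun n => ?_⟩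
  · exact iSup_le fun P => P.hullDetermined.encard_regions_le
  · exact ((hl n).trans (encard_range_le_encard_regions _)).trans
      (le_iSup (fun P : UnipointInput d n => (regions P.membershipProb).encard) _)
  · exact iSup_le fun P => P.hullDetermined.encard_faces_le
  · exact ((hl n).trans (encard_range_le_encard_faces _)).trans
      (le_iSup (fun P : UnipointInput d n => (faces P.membershipProb).encard) _)
  · exact iSup_le fun P => P.hullDetermined.encard_regions_le
  · refine ((hl n).trans (encard_range_le_encard_regions _)).trans ?_
    rw [← UnipointInput.membershipProb_toMultipoint]
    exact le_iSup (fun P : MultipointInput d n => (regions P.membershipProb).encard) _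
  · exact iSup_le fun P => P.hullDetermined.encard_faces_le
  · refine ((hl n).trans (encard_range_le_encard_faces _)).trans ?_
    rw [← UnipointInput.membershipProb_toMultipoint]
    exact le_iSup (fun P : MultipointInput d n => (faces P.membershipProb).encard) _
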